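/- Let $M_N$ be the space of real $N\times N$ matrices ($N\ge 1$). For $X\in M_N$ with singular values $\sigma_1,\dots,\sigma_N$ put $\|X\|_{S_p}=(\sum_i\sigma_i^p)^{1/p}$ ($\|\cdot\|_{S_1}$ is the nuclear norm, $\|\cdot\|_{S_2}$ the Frobenius norm) and $\rho_s(X)_{S_1}=\inf\{\|X-Y\|_{S_1}:\operatorname{rank}Y\le s\}$. Let $\mathcal A:M_N\to\mathbb R^m$ be linear and $s\ge 1$. Let $\alpha_{2s},\beta_{2s}\ge 0$ be the best constants in $$\alpha_{2s}\|Z\|_{S_2}\le\|\mathcal A Z\|_{\ell_2}\le\beta_{2s}\|Z\|_{S_2},\qquad \operatorname{rank}Z\le 2s,$$ and, when $\alpha_{2s}>0$, let $\gamma_{2s}=\beta_{2s}^2/\alpha_{2s}^2$. Let $\delta_{2s}(\mathcal A)$ be the smallest $\delta\ge0$ such that $(1-\delta)\|Z\|_{S_2}^2\le\|\mathcal A Z\|_{\ell_2}^2\le(1+\delta)\|Z\|_{S_2}^2$ whenever $\operatorname{rank} Z\le 2s$. For $\theta\ge 0$ and $y\in\mathbb R^m$ let $(P_{1,\theta})$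 be the problem of minimizing $\|Z\|_{S_1}$ subject to $\|\mathcal A Z-y\|_{\ell_2}\le\beta_{2s}\theta$, and let $(P_1)=(P_{1,0})$, whose constraint is $\mathcal A Z=y$. Suppose that $\alpha_{2s}>0$ and $\gamma_{2s}<4\sqrt2-3$. This condition holds if and only if $\delta_{2s}(c\mathcal A)<2(3-\sqrt2)/7$ for some scalar $c>0$; in particular it holds if $\delta_{2s}(\mathcal A)<2(3-\sqrt2)/7$. Then every matrix of rank at most $s$ is exactly and stably recovered by nuclear norm minimization, in the following sense. 1. (Exactness) If $\operatorname{rank}X\le s$, then $X$ is the unique solution of $(P_1)$ with $y=\mathcal A X$. 2. (Stability) There are constants $C_1,D_1,C_2,D_2$ depending only on $\gamma_{2s}$ such that for every $X\in M_N$, every $\theta\ge0$ and every $y$ with $\|\mathcal A X-y\|_{\ell_2}\le\beta_{2s}\theta$, the problem $(P_{1,\theta})$ has a solution and every solution $X^*$ satisfies $$\|X-X^*\|_{S_1}\le C_1\,\rho_s(X)_{S_1}+D_1\sqrt s\,\theta,\qquad \|X-X^*\|_{S_2}\le C_2\,\frac{\rho_s(X)_{S_1}}{\sqrt s}+D_2\,\theta.$$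 In particular ($\theta=0$, $y=\mathcal A X$) every solution $X^*$ of $(P_1)$ satisfies $\|X-X^*\|_{S_1}\le C_1\rho_s(X)_{S_1}$ and $\|X-X^*\|_{S_2}\le C_2\rho_s(X)_{S_1}/\sqrt s$. -/

import Mathlib

noncomputable section

namespace LowRankRecovery

/-- The space `M_N` of real `N × N` matrices. -/
abbrev Mat (N : ℕ) : Type := Matrix (Fin N) (Fin N) ℝ

/-- Linear measurement maps `M_N → ℝ^m`, with `ℝ^m` carrying the Euclidean norm. -/
abbrev Measurement (N m : ℕ) : Type := Mat N →ₗ[ℝ] EuclideanSpace ℝ (Fin m)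

/-- The `i`-th singular value of `X`, in non-increasing order and counted from `0`. -/
def singVal {N : ℕ} (X : Mat N) (i : Fin N) : ℝ :=
  (Matrix.toEuclideanLin X).singularValues i

/-- The Schatten `p`-(quasi-)norm, `(∑ σ_i ^ p) ^ (1 / p)`; the nuclear norm for `p = 1` and
the Frobenius norm for `p = 2`. -/
def schatten (p : ℝ) {N : ℕ} (X : Mat N) : ℝ :=
  (∑ i : Fin N, singVal X i ^ p) ^ (1 / p)

/-- The best rank-`s` approximation error of `X` in the Schatten `p`-(quasi-)norm. -/
def rho (p : ℝ) (s : ℕ) {N : ℕ} (X : Mat N) : ℝ :=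
  sInf {r : ℝ | ∃ Y : Mat N, Y.rank ≤ s ∧ r = schatten p (X - Y)}

/-- The largest `a ≥ 0` with `a ‖Z‖_{S_2} ≤ ‖A Z‖` for all `Z` of rank at most `r`. -/
def alpha {N m : ℕ} (A : Measurement N m) (r : ℕ) : ℝ :=
  sSup {a : ℝ | 0 ≤ a ∧ ∀ Z : Mat N, Z.rank ≤ r → a * schatten 2 Z ≤ ‖A Z‖}

/-- The smallest `b ≥ 0` with `‖A Z‖ ≤ b ‖Z‖_{S_2}` for all `Z` of rank at most `r`. -/
def beta {N m : ℕ} (A : Measurement N m) (r : ℕ) : ℝ :=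
  sInf {b : ℝ | 0 ≤ b ∧ ∀ Z : Mat N, Z.rank ≤ r → ‖A Z‖ ≤ b * schatten 2 Z}

/-- The scale-invariant ratio `β_r² / α_r²`; meaningful only when `0 < alpha A r`. -/
def gamma {N m : ℕ} (A : Measurement N m) (r : ℕ) : ℝ :=
  beta A r ^ 2 / alpha A r ^ 2

/-- The restricted isometry constant of `A` of rank `r`. -/
def ripConst {N m : ℕ} (A : Measurement N m) (r : ℕ) : ℝ :=
  sInf {δ : ℝ | 0 ≤ δ ∧ ∀ Z : Mat N, Z.rank ≤ r →
    (1 - δ) * schatten 2 Z ^ 2 ≤ ‖A Z‖ ^ 2 ∧ ‖A Z‖ ^ 2 ≤ (1 + δ) * schatten 2 Z ^ 2}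

/-- `Z` satisfies the constraint `‖A Z - y‖ ≤ β_{2s} θ`. For `θ = 0` this says `A Z = y`. -/
def Feasible {N m : ℕ} (A : Measurement N m) (s : ℕ) (θ : ℝ)
    (y : EuclideanSpace ℝ (Fin m)) (Z : Mat N) : Prop :=
  ‖A Z - y‖ ≤ beta A (2 * s) * θ

/-- `Xs` is a solution of the problem `(P_{p,θ})`: minimize `‖Z‖_{S_p}` subject to
`‖A Z - y‖ ≤ β_{2s} θ`. The problem `(P_p)` is the case `θ = 0`. -/
def IsSolution (p θ : ℝ) {N m : ℕ} (A : Measurement N m) (s : ℕ)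
    (y : EuclideanSpace ℝ (Fin m)) (Xs : Mat N) : Prop :=
  Feasible A s θ y Xs ∧ ∀ Z : Mat N, Feasible A s θ y Z → schatten p Xs ≤ schatten p Z

end LowRankRecovery

end

/-! Mirsky's inequality `∑ |σ_i(S) - σ_i(T)| ≤ ‖S - T‖_{S_1}` turns the matrix problem into one
about a single non-increasing sequence, the singular values `h` of the error `H = X - X^*`. Applied
to `X` and `H`, whose difference is `X^*`, it gives the cone condition: the tail of `h` past index
`s` exceeds its head by at most `2ρ_s(X)`. No alignment of singular spaces is needed. Mirsky's
inequality follows from the symmetric case (`sum_abs_eigenvalue_sub_le`) via the dilation with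
eigenvalues `±σ_i`.

In the singular bases of `H`, sequences with `2s` nonzero terms give matrices of rank at most `2s`,
so `A` acts as a restricted isometry on them. Cut `h` into blocks of length `s`. Images of distinct
blocks are nearly orthogonal, and the image of `H` has norm at most `2β_{2s}θ`, so each of the first
two blocks is controlled by `θ` plus `η = (1+√2)(γ-1)/4` times the sum of the later block norms
(`leading_blocks_le`). By monotonicity that sum is at most the tail divided by `√s`. With the cone
condition this bounds the tail by `η` times itself plus data, and `η < 1` is exactly `γ < 4√2 - 3`.
-/

noncomputable section

namespace LowRankRecovery

open scoped InnerProductSpace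

/-! ### Eigenvalue inequalities for symmetric operators -/

section Spectral

variable {F : Type*} [NormedAddCommGroup F] [InnerProductSpace ℝ F]

theorem inner_apply_self_eq_sum {ι : Type*} [Fintype ι] (e : OrthonormalBasis ι ℝ F)
    (A : F →ₗ[ℝ] F) (a : ι → ℝ) (hA : ∀ i, A (e i) = a i • e i) (x : F) :
    ⟪A x, x⟫_ℝ = ∑ i, a i * ⟪e i, x⟫_ℝ ^ 2 := by
  conv_lhs => rw [← e.sum_repr' x]
  rw [map_sum, e.sum_repr' x, sum_inner]
  refine Finset.sum_congr rfl fun i _ => ?_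
  rw [map_smul, hA, real_inner_smul_left, real_inner_smul_left]
  ring

/-- Weyl's monotonicity principle: sorted eigenvalues are monotone in the Loewner order. -/
theorem eigenvalue_le_of_inner_le {ι : Type*} [Fintype ι] [LinearOrder ι]
    (e f : OrthonormalBasis ι ℝ F) (A C : F →ₗ[ℝ] F) (a c : ι → ℝ) (ha : Antitone a)
    (hc : Antitone c) (hA : ∀ i, A (e i) = a i • e i) (hC : ∀ i, C (f i) = c i • f i)
    (hAC : ∀ x, ⟪A x, x⟫_ℝ ≤ ⟪C x, x⟫_ℝ) (i : ι) : a i ≤ c i := by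
  classical
  have : FiniteDimensional ℝ F := e.toBasis.finiteDimensional_of_finite
  -- One functional fewer than the dimension, so some `x ≠ 0` lies in the span of `e j`, `j ≤ i`,
  -- and in that of `f j`, `j ≥ i`.
  let L : F →ₗ[ℝ] ({j : ι // j ≠ i} → ℝ) :=
    LinearMap.pi fun j => if i < j.1 then (innerₗ F (e j.1)) else (innerₗ F (f j.1))
  have hL : L.ker ≠ ⊥ := by
    apply LinearMap.ker_ne_bot_of_finrank_lt
    rw [Module.finrank_fintype_fun_eq_card, Module.finrank_eq_card_basis e.toBasis]
    exact Fintype.card_subtype_lt (x := i) (by simp)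
  obtain ⟨x, hx, hx0⟩ := (Submodule.ne_bot_iff _).1 hL
  have hLx : ∀ j (hj : j ≠ i), L x ⟨j, hj⟩ = 0 := fun j hj => by
    rw [LinearMap.mem_ker.1 hx]; rfl
  have he : ∀ j, i < j → ⟪e j, x⟫_ℝ = 0 := fun j hj => by
    simpa [L, hj] using hLx j hj.ne'
  have hf : ∀ j, j < i → ⟪f j, x⟫_ℝ = 0 := fun j hj => by
    simpa [L, hj.not_gt] using hLx j hj.ne
  have h1 : a i * ‖x‖ ^ 2 ≤ ⟪A x, x⟫_ℝ := by
    rw [inner_apply_self_eq_sum e A a hA, ← e.sum_sq_inner_right x, Finset.mul_sum]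
    refine Finset.sum_le_sum fun j _ => ?_
    rcases le_or_gt j i with h | h
    · exact mul_le_mul_of_nonneg_right (ha h) (sq_nonneg _)
    · simp [he j h]
  have h2 : ⟪C x, x⟫_ℝ ≤ c i * ‖x‖ ^ 2 := by
    rw [inner_apply_self_eq_sum f C c hC, ← f.sum_sq_inner_right x, Finset.mul_sum]
    refine Finset.sum_le_sum fun j _ => ?_
    rcases lt_or_ge j i with h | h
    · simp [hf j h]
    · exact mul_le_mul_of_nonneg_right (hc h) (sq_nonneg _)
  have hpos : 0 < ‖x‖ ^ 2 := by positivity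
  exact le_of_mul_le_mul_right (h1.trans ((hAC x).trans h2)) hpos

/-- The operator that is diagonal in the orthonormal basis `g` with eigenvalues `d`. -/
def diagOp {κ : Type*} [Fintype κ] (g : OrthonormalBasis κ ℝ F) (d : κ → ℝ) : F →ₗ[ℝ] F :=
  ∑ j, (d j) • (innerₗ F (g j)).smulRight (g j)

theorem diagOp_apply {κ : Type*} [Fintype κ] (g : OrthonormalBasis κ ℝ F) (d : κ → ℝ) (x : F) :
    diagOp g d x = ∑ j, (d j * ⟪g j, x⟫_ℝ) • g j := by
  simp [diagOp, smul_smul]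

theorem diagOp_basis {κ : Type*} [Fintype κ] (g : OrthonormalBasis κ ℝ F) (d : κ → ℝ) (k : κ) :
    diagOp g d (g k) = d k • g k := by
  classical
  simp [diagOp_apply, orthonormal_iff_ite.1 g.orthonormal]

theorem inner_diagOp_self {κ : Type*} [Fintype κ] (g : OrthonormalBasis κ ℝ F) (d : κ → ℝ)
    (x : F) : ⟪diagOp g d x, x⟫_ℝ = ∑ j, d j * ⟪g j, x⟫_ℝ ^ 2 :=
  inner_apply_self_eq_sum g _ d (diagOp_basis g d) x

theorem isSymmetric_diagOp {κ : Type*} [Fintype κ] (g : OrthonormalBasis κ ℝ F) (d : κ → ℝ) :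
    (diagOp g d).IsSymmetric := by
  intro x y
  rw [diagOp_apply, diagOp_apply, sum_inner, inner_sum]
  refine Finset.sum_congr rfl fun j _ => ?_
  rw [real_inner_smul_left, real_inner_smul_right, real_inner_comm (g j) x]
  ring

theorem trace_of_eigenbasis {κ : Type*} [Fintype κ] (g : OrthonormalBasis κ ℝ F)
    (A : F →ₗ[ℝ] F) (d : κ → ℝ) (hA : ∀ i, A (g i) = d i • g i) :
    LinearMap.trace ℝ F A = ∑ j, d j := by
  rw [LinearMap.trace_eq_sum_inner A g]
  exact Finset.sum_congr rfl fun j _ => by simp [hA, real_inner_smul_right]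

/-- The Lidskii–Mirsky inequality for symmetric operators. -/
theorem sum_abs_eigenvalue_sub_le {ι κ : Type*} [Fintype ι] [LinearOrder ι] [Fintype κ]
    (e f : OrthonormalBasis ι ℝ F) (g : OrthonormalBasis κ ℝ F) (A B : F →ₗ[ℝ] F)
    (a b : ι → ℝ) (d : κ → ℝ) (ha : Antitone a) (hb : Antitone b)
    (hA : ∀ i, A (e i) = a i • e i) (hB : ∀ i, B (f i) = b i • f i)
    (hD : ∀ i, (A - B) (g i) = d i • g i) (hBs : B.IsSymmetric) :
    ∑ i, |a i - b i| ≤ ∑ j, |d j| := by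
  have : FiniteDimensional ℝ F := e.toBasis.finiteDimensional_of_finite
  -- `P` and `Q` are the positive and negative parts of `A - B`, so `B + P = A + Q` dominates both
  -- `A` and `B`. By Weyl its eigenvalues `c` dominate `a` and `b`, whence `|a - b| ≤ (c - a) + (c -
  -- b)`; the right side sums to `tr Q + tr P`.
  set P := diagOp g fun j => max (d j) 0 with hP
  set Q := diagOp g fun j => max (-d j) 0 with hQ
  have hBP : B + P = A + Q := by
    refine g.toBasis.ext fun j => ?_
    have h := hD j
    rw [LinearMap.sub_apply, sub_eq_iff_eq_add] at h
    simp only [OrthonormalBasis.coe_toBasis, LinearMap.add_apply, h, hP, hQ, diagOp_basis]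
    rcases le_total 0 (d j) with h0 | h0
    · rw [max_eq_left h0, max_eq_right (neg_nonpos.2 h0), zero_smul, add_zero, add_comm]
    · simp [max_eq_right h0, max_eq_left (neg_nonneg.2 h0), add_comm]
  have hCs : (B + P).IsSymmetric := hBs.add (isSymmetric_diagOp _ _)
  have hcard : Fintype.card ι = Module.finrank ℝ F :=
    (Module.finrank_eq_card_basis e.toBasis).symm
  let φ : Fin (Module.finrank ℝ F) ≃o ι := Fintype.orderIsoFinOfCardEq ι hcard
  let w : OrthonormalBasis ι ℝ F := (hCs.eigenvectorBasis rfl).reindex φ.toEquiv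
  let c : ι → ℝ := fun i => hCs.eigenvalues rfl (φ.symm i)
  have hc : Antitone c := fun i j hij =>
    hCs.eigenvalues_antitone rfl (φ.symm.monotone hij)
  have hC : ∀ i, (B + P) (w i) = c i • w i := fun i => by
    simpa [w, c] using hCs.apply_eigenvectorBasis rfl (φ.symm i)
  have hac : ∀ i, a i ≤ c i := eigenvalue_le_of_inner_le e w A (B + P) a c ha hc hA hC fun x => by
    rw [hBP, LinearMap.add_apply, inner_add_left, hQ, inner_diagOp_self]
    have : 0 ≤ ∑ j, max (-d j) 0 * ⟪g j, x⟫_ℝ ^ 2 := Finset.sum_nonneg fun j _ => by positivity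
    linarith
  have hbc : ∀ i, b i ≤ c i := eigenvalue_le_of_inner_le f w B (B + P) b c hb hc hB hC fun x => by
    rw [LinearMap.add_apply, inner_add_left, hP, inner_diagOp_self]
    have : 0 ≤ ∑ j, max (d j) 0 * ⟪g j, x⟫_ℝ ^ 2 := Finset.sum_nonneg fun j _ => by positivity
    linarith
  have t1 : ∑ i, c i = ∑ i, b i + ∑ j, max (d j) 0 := by
    rw [← trace_of_eigenbasis w _ c hC, map_add, trace_of_eigenbasis f B b hB,
      trace_of_eigenbasis g P _ (diagOp_basis g _)]
  have t2 : ∑ i, c i = ∑ i, a i + ∑ j, max (-d j) 0 := by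
    rw [← trace_of_eigenbasis w _ c hC, hBP, map_add, trace_of_eigenbasis e A a hA,
      trace_of_eigenbasis g Q _ (diagOp_basis g _)]
  have t3 : ∑ j, |d j| = ∑ j, max (d j) 0 + ∑ j, max (-d j) 0 := by
    rw [← Finset.sum_add_distrib]
    refine Finset.sum_congr rfl fun j _ => ?_
    rcases le_total 0 (d j) with h0 | h0
    · simp [abs_of_nonneg h0, h0]
    · simp [abs_of_nonpos h0, h0]
  calc ∑ i, |a i - b i| ≤ ∑ i, ((c i - a i) + (c i - b i)) :=
        Finset.sum_le_sum fun i _ => by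
          rw [abs_le]; constructor <;> linarith [hac i, hbc i]
    _ = ∑ j, |d j| := by
        rw [Finset.sum_add_distrib, Finset.sum_sub_distrib, Finset.sum_sub_distrib, t3]
        linarith

end Spectral

/-! ### Singular values and Mirsky's inequality -/

section SingularValueDecomposition

variable {E : Type*} [NormedAddCommGroup E] [InnerProductSpace ℝ E] [FiniteDimensional ℝ E]

/-- Singular value decomposition of an endomorphism of a Euclidean space. -/
theorem exists_singularValueDecomposition {n : ℕ} (hn : Module.finrank ℝ E = n)
    (T : E →ₗ[ℝ] E) :
    ∃ u v : OrthonormalBasis (Fin n) ℝ E,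
      (∀ i, T (v i) = T.singularValues i • u i) ∧
      ∀ i, LinearMap.adjoint T (u i) = T.singularValues i • v i := by
  classical
  let hS := T.isSymmetric_adjoint_comp_self
  let v := hS.eigenvectorBasis hn
  have hv : ∀ i, LinearMap.adjoint T (T (v i)) = (T.singularValues i ^ 2) • v i := fun i => by
    rw [T.sq_singularValues_fin hn]
    exact hS.apply_eigenvectorBasis hn i
  have hin : ∀ i j, ⟪T (v i), T (v j)⟫_ℝ = if i = j then T.singularValues i ^ 2 else 0 := by
    intro i j
    rw [← LinearMap.adjoint_inner_left, hv, real_inner_smul_left,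
      orthonormal_iff_ite.1 v.orthonormal]
    split_ifs <;> simp
  -- The normalized images `T (v i)` are orthonormal over the nonzero singular values; any
  -- orthonormal completion serves for the rest, where `T (v i) = 0`.
  let s : Set (Fin n) := {i | T.singularValues i ≠ 0}
  let w : Fin n → E := fun i => (T.singularValues i)⁻¹ • T (v i)
  have hw : Orthonormal ℝ (s.domRestrict w) := by
    rw [orthonormal_iff_ite]
    rintro ⟨i, hi⟩ ⟨j, hj⟩
    simp only [Set.domRestrict_apply, w, real_inner_smul_left, real_inner_smul_right, hin,
      Subtype.mk.injEq]
    split_ifs with h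
    · subst h
      have : T.singularValues i ≠ 0 := hi
      field_simp
    · simp
  obtain ⟨u, hu⟩ := hw.exists_orthonormalBasis_extension_of_card_eq (by simp [hn])
  have hT : ∀ i, T (v i) = T.singularValues i • u i := by
    intro i
    by_cases hi : T.singularValues i = 0
    · have := hin i i
      rw [if_pos rfl, hi] at this
      have h0 : T (v i) = 0 := by simpa using this
      rw [h0, hi, zero_smul]
    · rw [hu i hi]
      simp [w, smul_smul, hi]
  refine ⟨u, v, hT, fun i => ?_⟩
  refine InnerProductSpace.ext_inner_right_basis v.toBasis fun j => ?_
  rw [OrthonormalBasis.coe_toBasis, LinearMap.adjoint_inner_left, hT, real_inner_smul_left,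
    real_inner_smul_right, orthonormal_iff_ite.1 v.orthonormal,
    orthonormal_iff_ite.1 u.orthonormal]
  split_ifs with h
  · rw [h]
  · simp

/-- The symmetric dilation `(x, y) ↦ (T y, T† x)`. -/
def dilation (T : E →ₗ[ℝ] E) : WithLp 2 (E × E) →ₗ[ℝ] WithLp 2 (E × E) where
  toFun z := WithLp.toLp 2 (T z.snd, LinearMap.adjoint T z.fst)
  map_add' x y := (WithLp.ofLp_injective 2) (by simp)
  map_smul' c x := (WithLp.ofLp_injective 2) (by simp)

theorem dilation_toLp (T : E →ₗ[ℝ] E) (x y : E) :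
    dilation T (WithLp.toLp 2 (x, y)) = WithLp.toLp 2 (T y, LinearMap.adjoint T x) := rfl

theorem dilation_sub (S T : E →ₗ[ℝ] E) : dilation (S - T) = dilation S - dilation T := by
  ext x
  exact (WithLp.ofLp_injective 2) (by simp [dilation])

theorem isSymmetric_dilation (T : E →ₗ[ℝ] E) : (dilation T).IsSymmetric := by
  intro x y
  simp only [dilation, LinearMap.coe_mk, AddHom.coe_mk, WithLp.prod_inner_apply,
    LinearMap.adjoint_inner_left, LinearMap.adjoint_inner_right]
  exact add_comm _ _

/-- Eigenvalues of the dilation, in non-increasing order. -/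
def dilationEigenvalue (T : E →ₗ[ℝ] E) (n : ℕ) : Fin n ⊕ₗ (Fin n)ᵒᵈ → ℝ := fun i =>
  Sum.elim (fun i : Fin n => T.singularValues i)
    (fun i : (Fin n)ᵒᵈ => -T.singularValues (OrderDual.ofDual i : Fin n)) (ofLex i)

/-- Reversing the second copy of `Fin n` makes the list `σ_0, …, σ_{n-1}, -σ_{n-1}, …, -σ_0` sorted,
as the symmetric inequality requires. -/
theorem antitone_dilationEigenvalue (T : E →ₗ[ℝ] E) (n : ℕ) :
    Antitone (dilationEigenvalue T n) := by
  intro i j hij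
  induction i using Lex.rec with | _ i
  induction j using Lex.rec with | _ j
  rcases i with i | i <;> rcases j with j | j
  · exact T.singularValues_antitone (by simpa using hij)
  · simp only [dilationEigenvalue, ofLex_toLex, Sum.elim_inl, Sum.elim_inr]
    linarith [T.singularValues_nonneg i, T.singularValues_nonneg (OrderDual.ofDual j : Fin n)]
  · simp at hij
  · refine neg_le_neg (T.singularValues_antitone ?_)
    simpa using hij

/-- The eigenvectors are `(u_i, ±v_i)/√2`, for singular vectors `u_i`, `v_i`. -/
theorem exists_eigenbasis_dilation {n : ℕ} (hn : Module.finrank ℝ E = n) (T : E →ₗ[ℝ] E) :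
    ∃ e : OrthonormalBasis (Fin n ⊕ₗ (Fin n)ᵒᵈ) ℝ (WithLp 2 (E × E)),
      ∀ i, dilation T (e i) = dilationEigenvalue T n i • e i := by
  classical
  obtain ⟨u, v, hT, hT'⟩ := exists_singularValueDecomposition hn T
  let w : Fin n ⊕ₗ (Fin n)ᵒᵈ → WithLp 2 (E × E) := fun i =>
    Sum.elim (fun i : Fin n => WithLp.toLp 2 ((√2)⁻¹ • u i, (√2)⁻¹ • v i))
      (fun i : (Fin n)ᵒᵈ => WithLp.toLp 2 ((√2)⁻¹ • u (OrderDual.ofDual i),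
        -((√2)⁻¹ • v (OrderDual.ofDual i)))) (ofLex i)
  have hu := orthonormal_iff_ite.1 u.orthonormal
  have hv := orthonormal_iff_ite.1 v.orthonormal
  have h2 : (√2)⁻¹ * ((√2)⁻¹ * 2) = (1 : ℝ) := by
    rw [← mul_assoc, ← mul_inv, Real.mul_self_sqrt (by norm_num)]; norm_num
  have hw : Orthonormal ℝ w := by
    rw [orthonormal_iff_ite]
    intro i j
    induction i using Lex.rec with | _ i
    induction j using Lex.rec with | _ j
    rcases i with i | i <;> rcases j with j | j <;>
      simp only [w, ofLex_toLex, Sum.elim_inl, Sum.elim_inr, real_inner_smul_left,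
        real_inner_smul_right, WithLp.prod_inner_apply, hu, hv, inner_neg_left, inner_neg_right,
        toLex_inj, Sum.inl.injEq, Sum.inr.injEq, reduceCtorEq, if_false] <;>
      split_ifs <;> simp_all <;> linarith
  have hcard : Fintype.card (Fin n ⊕ₗ (Fin n)ᵒᵈ) = Module.finrank ℝ (WithLp 2 (E × E)) := by
    rw [(WithLp.linearEquiv 2 ℝ (E × E)).finrank_eq, Module.finrank_prod, hn]
    simp [Lex]
  obtain ⟨e, he⟩ := Orthonormal.exists_orthonormalBasis_extension_of_card_eq (𝕜 := ℝ)
    (v := w) (s := Set.univ) hcard.symm (hw.comp _ Subtype.val_injective)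
  refine ⟨e, fun i => ?_⟩
  rw [he i (Set.mem_univ i)]
  induction i using Lex.rec with | _ i
  rcases i with i | i
  · simp only [w, dilationEigenvalue, ofLex_toLex, Sum.elim_inl, dilation_toLp, map_smul, hT, hT']
    exact (WithLp.ofLp_injective 2) (by simp [smul_smul, mul_comm])
  · simp only [w, dilationEigenvalue, ofLex_toLex, Sum.elim_inr, dilation_toLp, map_smul, map_neg,
      hT, hT']
    exact (WithLp.ofLp_injective 2) (by simp [smul_smul, mul_comm])

/-- Mirsky's inequality for the nuclear norm. -/
theorem sum_abs_singularValues_sub_le {n : ℕ} (hn : Module.finrank ℝ E = n)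
    (S T : E →ₗ[ℝ] E) :
    ∑ i : Fin n, |S.singularValues i - T.singularValues i| ≤
      ∑ i : Fin n, (S - T).singularValues i := by
  obtain ⟨e, he⟩ := exists_eigenbasis_dilation hn S
  obtain ⟨f, hf⟩ := exists_eigenbasis_dilation hn T
  obtain ⟨g, hg⟩ := exists_eigenbasis_dilation hn (S - T)
  rw [dilation_sub] at hg
  have key := sum_abs_eigenvalue_sub_le e f g _ _ _ _ _ (antitone_dilationEigenvalue S n)
    (antitone_dilationEigenvalue T n) he hf hg (isSymmetric_dilation T)
  have h1 : ∀ p : Fin n ⊕ₗ (Fin n)ᵒᵈ → ℝ, ∑ i, p i =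
      ∑ i : Fin n, p (toLex (Sum.inl i)) + ∑ i : Fin n, p (toLex (Sum.inr (OrderDual.toDual i))) :=
    fun p => by
      rw [← Equiv.sum_comp toLex p, Fintype.sum_sum_type]
      rfl
  -- Each index contributes twice on both sides, through `σ` and `-σ`; the factor 2 cancels.
  rw [h1, h1] at key
  have h2 : ∀ x y : ℝ, |-x - -y| = |x - y| := fun x y => by rw [← abs_neg]; congr 1; ring
  simp only [dilationEigenvalue, ofLex_toLex, Sum.elim_inl, Sum.elim_inr, OrderDual.ofDual_toDual,
    abs_neg, h2, abs_of_nonneg ((S - T).singularValues_nonneg _)] at key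
  linarith

end SingularValueDecomposition

/-! ### Schatten norms, existence of minimizers, synthesis from singular bases -/

section Matrices

variable {N m : ℕ}

theorem singVal_nonneg (X : Mat N) (i : Fin N) : 0 ≤ singVal X i :=
  LinearMap.singularValues_nonneg _ _

theorem schatten_one (X : Mat N) : schatten 1 X = ∑ i, singVal X i := by
  simp [schatten]

theorem schatten_two (X : Mat N) : schatten 2 X = √(∑ i, singVal X i ^ 2) := by
  simp [schatten, Real.sqrt_eq_rpow]

theorem schatten_one_nonneg (X : Mat N) : 0 ≤ schatten 1 X := by
  rw [schatten_one]
  exact Finset.sum_nonneg fun i _ => singVal_nonneg X i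

theorem schatten_two_nonneg (X : Mat N) : 0 ≤ schatten 2 X := by
  rw [schatten_two]
  positivity

theorem sq_schatten_two (X : Mat N) : schatten 2 X ^ 2 = ∑ i, singVal X i ^ 2 := by
  rw [schatten_two, Real.sq_sqrt (Finset.sum_nonneg fun i _ => sq_nonneg _)]

theorem schatten_two_le_schatten_one (X : Mat N) : schatten 2 X ≤ schatten 1 X := by
  rw [schatten_two, schatten_one]
  exact Real.sqrt_le_iff.2 ⟨Finset.sum_nonneg fun i _ => singVal_nonneg X i,
    Finset.sum_sq_le_sq_sum_of_nonneg fun i _ => singVal_nonneg X i⟩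

theorem schatten_one_le_schatten_two (X : Mat N) : schatten 1 X ≤ √N * schatten 2 X := by
  rw [schatten_two, schatten_one, ← Real.sqrt_mul (Nat.cast_nonneg N)]
  apply Real.le_sqrt_of_sq_le
  simpa using sq_sum_le_card_mul_sum_sq (s := Finset.univ) (f := fun i => singVal X i)

theorem sum_abs_singVal_sub_le (X Y : Mat N) :
    ∑ i, |singVal X i - singVal Y i| ≤ schatten 1 (X - Y) := by
  rw [schatten_one]
  simp only [singVal, map_sub]
  exact sum_abs_singularValues_sub_le (by simp) _ _

/-- Mirsky's inequality stands in for the triangle inequality of the nuclear norm; continuity of the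
norm follows. -/
theorem abs_schatten_one_sub_le (X Y : Mat N) :
    |schatten 1 X - schatten 1 Y| ≤ schatten 1 (X - Y) := by
  refine le_trans ?_ (sum_abs_singVal_sub_le X Y)
  rw [schatten_one, schatten_one, ← Finset.sum_sub_distrib]
  exact Finset.abs_sum_le_sum_abs _ _

/-- The Frobenius norm can be computed in any orthonormal basis. -/
theorem sq_schatten_two_eq_sum_norm (X : Mat N)
    (v : OrthonormalBasis (Fin N) ℝ (EuclideanSpace ℝ (Fin N))) :
    schatten 2 X ^ 2 = ∑ i, ‖Matrix.toEuclideanLin X (v i)‖ ^ 2 := by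
  have key (w : OrthonormalBasis (Fin N) ℝ (EuclideanSpace ℝ (Fin N))) :
      LinearMap.trace ℝ _ (LinearMap.adjoint (Matrix.toEuclideanLin X) ∘ₗ
        Matrix.toEuclideanLin X) = ∑ i, ‖Matrix.toEuclideanLin X (w i)‖ ^ 2 := by
    rw [LinearMap.trace_eq_sum_inner _ w]
    refine Finset.sum_congr rfl fun i _ => ?_
    rw [LinearMap.comp_apply, LinearMap.adjoint_inner_right, real_inner_self_eq_norm_sq]
  obtain ⟨u, w, hw, -⟩ := exists_singularValueDecomposition (n := N) (by simp)
    (Matrix.toEuclideanLin X)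
  rw [sq_schatten_two, ← key v, key w]
  simp [hw, norm_smul, singVal]

theorem sq_schatten_two_eq_sum_entries (X : Mat N) :
    schatten 2 X ^ 2 = ∑ j, ∑ i, X i j ^ 2 := by
  rw [sq_schatten_two_eq_sum_norm X (EuclideanSpace.basisFun (Fin N) ℝ)]
  refine Finset.sum_congr rfl fun j _ => ?_
  rw [EuclideanSpace.norm_sq_eq]
  simp [Matrix.toLpLin_apply]

theorem abs_entry_le_schatten_two (X : Mat N) (i j : Fin N) : |X i j| ≤ schatten 2 X := by
  refine abs_le_of_sq_le_sq ?_ (schatten_two_nonneg X)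
  rw [sq_schatten_two_eq_sum_entries]
  exact (Finset.single_le_sum (f := fun i => X i j ^ 2) (fun i _ => sq_nonneg _)
    (Finset.mem_univ i)).trans (Finset.single_le_sum (f := fun j => ∑ i, X i j ^ 2)
    (fun j _ => Finset.sum_nonneg fun i _ => sq_nonneg _) (Finset.mem_univ j))

theorem schatten_two_eq_zero {X : Mat N} (h : schatten 2 X = 0) : X = 0 := by
  ext i j
  have := abs_entry_le_schatten_two X i j
  rw [h] at this
  simpa using this

theorem schatten_two_smul (c : ℝ) (X : Mat N) : schatten 2 (c • X) = |c| * schatten 2 X := by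
  rw [← sq_eq_sq₀ (schatten_two_nonneg _) (mul_nonneg (abs_nonneg c) (schatten_two_nonneg _)),
    mul_pow, sq_abs, sq_schatten_two_eq_sum_entries, sq_schatten_two_eq_sum_entries]
  simp [mul_pow, Finset.mul_sum]

theorem continuous_schatten_two : Continuous (schatten 2 : Mat N → ℝ) := by
  have : (schatten 2 : Mat N → ℝ) = fun X => √(∑ j, ∑ i, X i j ^ 2) := by
    ext X
    rw [← sq_schatten_two_eq_sum_entries, Real.sqrt_sq (schatten_two_nonneg X)]
  rw [this]
  fun_prop

theorem continuous_schatten_one : Continuous (schatten 1 : Mat N → ℝ) := by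
  rw [continuous_iff_continuousAt]
  intro X
  rw [ContinuousAt, tendsto_iff_dist_tendsto_zero]
  refine squeeze_zero (fun _ => dist_nonneg) (fun Y => ?_)
    (g := fun Y => √N * schatten 2 (Y - X)) ?_
  · rw [Real.dist_eq]
    exact (abs_schatten_one_sub_le Y X).trans (schatten_one_le_schatten_two _)
  · have h : Continuous fun Y : Mat N => √N * schatten 2 (Y - X) :=
      continuous_const.mul (continuous_schatten_two.comp (continuous_id.sub continuous_const))
    have h0 : schatten 2 (X - X) = 0 := by
      rw [sub_self, ← zero_smul ℝ (0 : Mat N), schatten_two_smul]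
      simp
    simpa only [h0, mul_zero] using h.tendsto X

theorem continuous_measurement (A : Measurement N m) : Continuous A :=
  A.continuous_of_finiteDimensional

/-- Feasible matrices of nuclear norm at most that of `X` form a closed set; entries are bounded by
the nuclear norm, so it is compact. -/
theorem exists_isSolution (A : Measurement N m) (s : ℕ) (θ : ℝ) (y : EuclideanSpace ℝ (Fin m))
    (X : Mat N) (hX : Feasible A s θ y X) : ∃ Xs : Mat N, IsSolution 1 θ A s y Xs := by
  let K : Set (Mat N) := {Z | Feasible A s θ y Z ∧ schatten 1 Z ≤ schatten 1 X}
  have hcl : IsClosed K :=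
    (isClosed_le ((continuous_measurement A).sub continuous_const).norm continuous_const).inter
      (isClosed_le continuous_schatten_one continuous_const)
  let B : Set (Mat N) := Set.univ.pi fun _ => Set.univ.pi fun _ =>
    Set.Icc (-schatten 1 X) (schatten 1 X)
  have hB : IsCompact B :=
    isCompact_univ_pi fun _ => isCompact_univ_pi fun _ => isCompact_Icc
  have hK : IsCompact K := hB.of_isClosed_subset hcl fun Z hZ i _ j _ =>
    abs_le.1 ((abs_entry_le_schatten_two Z i j).trans
      ((schatten_two_le_schatten_one Z).trans hZ.2))
  obtain ⟨Xs, hXs, hmin⟩ := hK.exists_isMinOn ⟨X, hX, le_rfl⟩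
    continuous_schatten_one.continuousOn
  refine ⟨Xs, hXs.1, fun Z hZ => ?_⟩
  rcases le_total (schatten 1 Z) (schatten 1 X) with h | h
  · exact hmin ⟨hZ, h⟩
  · exact hXs.2.trans h

/-- The matrix `∑ c i • u i (v i)ᵀ` with coefficients the first `N` terms of a sequence. -/
def synthesis (u v : OrthonormalBasis (Fin N) ℝ (EuclideanSpace ℝ (Fin N))) :
    (ℕ → ℝ) →ₗ[ℝ] Mat N where
  toFun c := ∑ i : Fin N, c i • Matrix.vecMulVec (u i) (v i)
  map_add' c d := by simp [add_smul, Finset.sum_add_distrib]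
  map_smul' r c := by simp [Finset.smul_sum, smul_smul]

theorem toEuclideanLin_synthesis (u v : OrthonormalBasis (Fin N) ℝ (EuclideanSpace ℝ (Fin N)))
    (c : ℕ → ℝ) (i : Fin N) :
    Matrix.toEuclideanLin (synthesis u v c) (v i) = c i • u i := by
  classical
  have hv := orthonormal_iff_ite.1 v.orthonormal
  have h : ∀ j, Matrix.toEuclideanLin (Matrix.vecMulVec (u j) (v j)) (v i) =
      if j = i then u j else 0 := by
    intro j
    have h1 : (v j : Fin N → ℝ) ⬝ᵥ (v i) = if j = i then 1 else 0 := by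
      rw [← hv j i, EuclideanSpace.inner_eq_star_dotProduct, dotProduct_comm]
      rfl
    refine (WithLp.ofLp_injective 2) ?_
    rw [Matrix.toLpLin_apply, Matrix.vecMulVec_mulVec, h1]
    split_ifs <;> simp
  simp [synthesis, h]

theorem sq_schatten_two_synthesis
    (u v : OrthonormalBasis (Fin N) ℝ (EuclideanSpace ℝ (Fin N))) (c : ℕ → ℝ) :
    schatten 2 (synthesis u v c) ^ 2 = ∑ i : Fin N, c i ^ 2 := by
  rw [sq_schatten_two_eq_sum_norm _ v]
  simp [toEuclideanLin_synthesis, norm_smul]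

theorem rank_add_le (X Y : Mat N) : (X + Y).rank ≤ X.rank + Y.rank := by
  rw [Matrix.rank, Matrix.rank, Matrix.rank, Matrix.mulVecLin_add]
  exact (Submodule.finrank_mono (LinearMap.range_add_le _ _)).trans
    (Submodule.finrank_add_le_finrank_add_finrank _ _)

theorem rank_synthesis_le (u v : OrthonormalBasis (Fin N) ℝ (EuclideanSpace ℝ (Fin N)))
    (c : ℕ → ℝ) (S : Finset ℕ) (hc : ∀ i ∉ S, c i = 0) :
    (synthesis u v c).rank ≤ S.card := by
  classical
  have h : ∀ (t : Finset (Fin N)), (∑ i ∈ t, c i • Matrix.vecMulVec (u i) (v i)).rank ≤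
      (t.filter fun i : Fin N => (i : ℕ) ∈ S).card := by
    intro t
    induction t using Finset.induction_on with
    | empty => simp
    | insert a t ha ih =>
      rw [Finset.sum_insert ha, Finset.filter_insert]
      split_ifs with h
      · rw [Finset.card_insert_of_notMem (by simp [ha]), add_comm _ 1]
        refine (rank_add_le _ _).trans (add_le_add ?_ ih)
        rw [← Matrix.smul_vecMulVec]
        exact Matrix.rank_vecMulVec_le _ _
      · rwa [hc _ h, zero_smul, zero_add]
  refine (h Finset.univ).trans ?_
  exact Finset.card_le_card_of_injOn (fun i : Fin N => (i : ℕ)) (fun i hi => by simpa using hi)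
    Fin.val_injective.injOn

theorem exists_synthesis_eq (X : Mat N) :
    ∃ u v : OrthonormalBasis (Fin N) ℝ (EuclideanSpace ℝ (Fin N)),
      synthesis u v (Matrix.toEuclideanLin X).singularValues = X := by
  obtain ⟨u, v, h, -⟩ := exists_singularValueDecomposition (n := N) (by simp)
    (Matrix.toEuclideanLin X)
  refine ⟨u, v, Matrix.toEuclideanLin.injective (v.toBasis.ext fun i => ?_)⟩
  rw [OrthonormalBasis.coe_toBasis, toEuclideanLin_synthesis, h]

theorem singVal_eq_zero_of_rank_le {X : Mat N} {i : Fin N} (h : X.rank ≤ i) :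
    singVal X i = 0 := by
  rw [singVal, LinearMap.singularValues_eq_zero_iff_le_finrank_range]
  rwa [Matrix.rank_eq_finrank_range_toLin X (EuclideanSpace.basisFun (Fin N) ℝ).toBasis
    (EuclideanSpace.basisFun (Fin N) ℝ).toBasis] at h

end Matrices

/-! ### Restricted isometry and the two leading blocks -/

section Blocks

variable {V : Type*} [NormedAddCommGroup V] [InnerProductSpace ℝ V]

/-- The hypothesis places `(x, y)` in the disc with centre `(c, c)` and radius `√2 c`. This is the
source of the factor `1 + √2`. -/
theorem le_of_sq_add_sq_le {x y c : ℝ} (hc : 0 ≤ c) (h : x ^ 2 + y ^ 2 ≤ 2 * c * (x + y)) :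
    x ≤ (1 + √2) * c := by
  have h1 : x - c ≤ √2 * c := by
    refine le_of_sq_le_sq ?_ (by positivity)
    rw [mul_pow, Real.sq_sqrt (by norm_num)]
    nlinarith [sq_nonneg (y - c)]
  linarith

/-- Near-orthogonality of the images of two blocks under a restricted isometry. -/
theorem abs_inner_le_of_restricted_isometry {x y : V} {a b α β : ℝ} (ha : 0 ≤ a) (hb : 0 ≤ b)
    (h : ∀ p q : ℝ, α ^ 2 * (p ^ 2 * a ^ 2 + q ^ 2 * b ^ 2) ≤ ‖p • x + q • y‖ ^ 2 ∧
      ‖p • x + q • y‖ ^ 2 ≤ β ^ 2 * (p ^ 2 * a ^ 2 + q ^ 2 * b ^ 2)) :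
    |⟪x, y⟫_ℝ| ≤ (β ^ 2 - α ^ 2) / 2 * (a * b) := by
  have hexp : ∀ p q : ℝ, ‖p • x + q • y‖ ^ 2 =
      p ^ 2 * ‖x‖ ^ 2 + 2 * (p * q * ⟪x, y⟫_ℝ) + q ^ 2 * ‖y‖ ^ 2 := fun p q => by
    rw [norm_add_sq_real, norm_smul, norm_smul, real_inner_smul_left, real_inner_smul_right,
      mul_pow, mul_pow, Real.norm_eq_abs, Real.norm_eq_abs, sq_abs, sq_abs]
    ring
  rcases ha.eq_or_lt with h0 | ha
  · have hx : ‖x‖ ^ 2 ≤ 0 := by simpa [← h0] using (h 1 0).2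
    have : x = 0 := by simpa using le_antisymm hx (sq_nonneg _)
    simp [this, ← h0]
  rcases hb.eq_or_lt with h0 | hb
  · have hy : ‖y‖ ^ 2 ≤ 0 := by simpa [← h0] using (h 0 1).2
    have : y = 0 := by simpa using le_antisymm hy (sq_nonneg _)
    simp [this, ← h0]
  have hab : 0 < a * b := mul_pos ha hb
  -- The weights `b` and `±a` give both vectors the same model norm `ab`; polarization compares the
  -- two bounds.
  have h1 := h b a
  have h2 := h b (-a)
  rw [hexp] at h1 h2
  rw [abs_le]
  constructor
  · refine le_of_mul_le_mul_left ?_ hab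
    nlinarith [h1.1, h2.2]
  · refine le_of_mul_le_mul_left ?_ hab
    nlinarith [h1.2, h2.1]

/-- Write `‖w 0 + w 1‖²` as its inner product with the full sum, minus the inner products with later
blocks. The first is small by `hS`, the others by near-orthogonality, and the lower isometry bound
leaves a quadratic inequality in `b 0`, `b 1`. -/
theorem leading_blocks_le (w : ℕ → V) (b : ℕ → ℝ) (hb : ∀ k, 0 ≤ b k) {α β τ : ℝ} (hα : 0 < α)
    (hαβ : α ≤ β) (hτ : 0 ≤ τ) (K : ℕ)
    (hw : ∀ j k, j ≠ k → ∀ p q : ℝ,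
      α ^ 2 * (p ^ 2 * b j ^ 2 + q ^ 2 * b k ^ 2) ≤ ‖p • w j + q • w k‖ ^ 2 ∧
      ‖p • w j + q • w k‖ ^ 2 ≤ β ^ 2 * (p ^ 2 * b j ^ 2 + q ^ 2 * b k ^ 2))
    (hS : ‖∑ k ∈ Finset.range (K + 2), w k‖ ≤ 2 * β * τ) :
    b 0 ≤ (1 + √2) * (β ^ 2 / α ^ 2 * τ +
        (β ^ 2 / α ^ 2 - 1) / 4 * ∑ k ∈ Finset.range K, b (k + 2)) ∧
      b 1 ≤ (1 + √2) * (β ^ 2 / α ^ 2 * τ +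
        (β ^ 2 / α ^ 2 - 1) / 4 * ∑ k ∈ Finset.range K, b (k + 2)) := by
  set σ := ∑ k ∈ Finset.range K, b (k + 2) with hσ
  set c := β ^ 2 / α ^ 2 * τ + (β ^ 2 / α ^ 2 - 1) / 4 * σ with hc
  have hβ : 0 ≤ β := hα.le.trans hαβ
  have hσ0 : 0 ≤ σ := Finset.sum_nonneg fun k _ => hb _
  have hγ : 1 ≤ β ^ 2 / α ^ 2 := by
    rw [one_le_div (by positivity)]
    exact pow_le_pow_left₀ hα.le hαβ 2
  have hc0 : 0 ≤ c := by
    have : 0 ≤ β ^ 2 / α ^ 2 - 1 := by linarith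
    positivity
  have hn : ∀ k, ‖w k‖ ≤ β * b k := fun k => by
    refine le_of_sq_le_sq ?_ (mul_nonneg hβ (hb k))
    -- The partner `k + 1` is arbitrary: its coefficient is zero.
    have := (hw k (k + 1) (by simp) 1 0).2
    simp only [one_smul, zero_smul, add_zero] at this
    linarith
  set R := ∑ k ∈ Finset.range K, w (k + 2) with hR
  have hI : ∀ i, i < 2 → |⟪w i, R⟫_ℝ| ≤ (β ^ 2 - α ^ 2) / 2 * (b i * σ) := fun i hi => by
    rw [hR, inner_sum, hσ, Finset.mul_sum, Finset.mul_sum]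
    refine (Finset.abs_sum_le_sum_abs _ _).trans (Finset.sum_le_sum fun k _ => ?_)
    exact abs_inner_le_of_restricted_isometry (hb _) (hb _) (hw i (k + 2) (by omega))
  have hu : ‖w 0 + w 1‖ ^ 2 = ⟪w 0 + w 1, ∑ k ∈ Finset.range (K + 2), w k⟫_ℝ
      - ⟪w 0, R⟫_ℝ - ⟪w 1, R⟫_ℝ := by
    rw [Finset.sum_range_succ', Finset.sum_range_succ', ← hR, ← real_inner_self_eq_norm_sq]
    simp only [inner_add_left, inner_add_right]
    ring
  have h1 : ⟪w 0 + w 1, ∑ k ∈ Finset.range (K + 2), w k⟫_ℝ ≤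
      (β * (b 0 + b 1)) * (2 * β * τ) := by
    refine (real_inner_le_norm _ _).trans (mul_le_mul ?_ hS (norm_nonneg _) ?_)
    · linarith [norm_add_le (w 0) (w 1), hn 0, hn 1]
    · exact mul_nonneg hβ (add_nonneg (hb 0) (hb 1))
  have h2 := (hw 0 1 (by simp) 1 1).1
  simp only [one_smul, one_pow, one_mul] at h2
  have h3 := (abs_le.1 (hI 0 (by simp))).1
  have h4 := (abs_le.1 (hI 1 (by simp))).1
  have hcα : α ^ 2 * c = β ^ 2 * τ + (β ^ 2 - α ^ 2) / 4 * σ := by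
    rw [hc]
    field_simp
  have hq : b 0 ^ 2 + b 1 ^ 2 ≤ 2 * c * (b 0 + b 1) := by
    have hα2 : 0 < α ^ 2 := by positivity
    refine le_of_mul_le_mul_left ?_ hα2
    calc α ^ 2 * (b 0 ^ 2 + b 1 ^ 2) ≤ β * (b 0 + b 1) * (2 * β * τ)
          + (β ^ 2 - α ^ 2) / 2 * (b 0 * σ) + (β ^ 2 - α ^ 2) / 2 * (b 1 * σ) := by linarith
      _ = 2 * (α ^ 2 * c) * (b 0 + b 1) := by rw [hcα]; ring
      _ = α ^ 2 * (2 * c * (b 0 + b 1)) := by ring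
  exact ⟨le_of_sq_add_sq_le hc0 hq, le_of_sq_add_sq_le (y := b 0) hc0 (by linarith)⟩

end Blocks

/-! ### Block decomposition of a non-increasing sequence -/

section Sequences

theorem sum_sum_Ico_mul (f : ℕ → ℝ) (s K : ℕ) :
    ∑ k ∈ Finset.range K, ∑ i ∈ Finset.Ico (k * s) ((k + 1) * s), f i =
      ∑ i ∈ Finset.range (K * s), f i := by
  induction K with
  | zero => simp
  | succ K ih =>
    rw [Finset.sum_range_succ, ih, Finset.range_eq_Ico, Finset.range_eq_Ico,
      Finset.sum_Ico_consecutive _ (Nat.zero_le _) (Nat.mul_le_mul_right s K.le_succ)]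

/-- The `k`-th block of length `s` of a sequence. -/
def block (h : ℕ → ℝ) (s k : ℕ) : ℕ → ℝ := fun i =>
  if i ∈ Finset.Ico (k * s) ((k + 1) * s) then h i else 0

theorem sum_block {h : ℕ → ℝ} {s K : ℕ} (hh : ∀ i, K * s ≤ i → h i = 0) :
    ∑ k ∈ Finset.range K, block h s k = h := by
  ext i
  have key : ∀ n, (∑ k ∈ Finset.range n, block h s k) i = if i < n * s then h i else 0 := by
    intro n
    induction n with
    | zero => simp
    | succ n ih =>
      rw [Finset.sum_range_succ, Pi.add_apply, ih, block]
      have : n * s ≤ (n + 1) * s := Nat.mul_le_mul_right s n.le_succ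
      simp only [Finset.mem_Ico]
      split_ifs <;> first | omega | simp
  rw [key]
  split_ifs with hi
  · rfl
  · exact (hh i (not_lt.1 hi)).symm

/-- The Euclidean norm of the `k`-th block. -/
def blockNorm (h : ℕ → ℝ) (s k : ℕ) : ℝ :=
  √(∑ i ∈ Finset.Ico (k * s) ((k + 1) * s), h i ^ 2)

theorem sq_blockNorm (h : ℕ → ℝ) (s k : ℕ) :
    blockNorm h s k ^ 2 = ∑ i ∈ Finset.Ico (k * s) ((k + 1) * s), h i ^ 2 :=
  Real.sq_sqrt (Finset.sum_nonneg fun _ _ => sq_nonneg _)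

theorem card_block (s k : ℕ) : (Finset.Ico (k * s) ((k + 1) * s)).card = s := by
  rw [Nat.card_Ico, add_mul, one_mul, Nat.add_sub_cancel_left]

/-- The first entry `M` of block `k + 1` bounds that block from above and block `k` from below, so
both sides compare with `√s M`. -/
theorem blockNorm_succ_le {h : ℕ → ℝ} (hh : Antitone h) (h0 : ∀ i, 0 ≤ h i) {s : ℕ} (hs : 0 < s)
    (k : ℕ) :
    blockNorm h s (k + 1) ≤ (∑ i ∈ Finset.Ico (k * s) ((k + 1) * s), h i) / √s := by
  set M := h ((k + 1) * s)
  have hM : 0 ≤ M := h0 _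
  have hs' : (0 : ℝ) < √s := Real.sqrt_pos.2 (by exact_mod_cast hs)
  have hss : √(s : ℝ) ^ 2 = s := Real.sq_sqrt (Nat.cast_nonneg s)
  have h1 : (s : ℝ) * M ≤ ∑ i ∈ Finset.Ico (k * s) ((k + 1) * s), h i := by
    have := Finset.card_nsmul_le_sum (Finset.Ico (k * s) ((k + 1) * s)) h M
      fun _ hi => hh (Finset.mem_Ico.1 hi).2.le
    rwa [card_block, nsmul_eq_mul] at this
  have h2 : blockNorm h s (k + 1) ^ 2 ≤ s * M ^ 2 := by
    rw [sq_blockNorm]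
    have := Finset.sum_le_card_nsmul (Finset.Ico ((k + 1) * s) ((k + 1 + 1) * s))
      (fun i => h i ^ 2) (M ^ 2)
      fun i hi => pow_le_pow_left₀ (h0 i) (hh (Finset.mem_Ico.1 hi).1) 2
    rwa [card_block, nsmul_eq_mul] at this
  rw [le_div_iff₀ hs']
  refine le_trans (le_of_sq_le_sq ?_ (by positivity)) h1
  rw [mul_pow, mul_pow, hss]
  nlinarith [(Nat.cast_nonneg s : (0 : ℝ) ≤ s)]

theorem sum_block_le (h : ℕ → ℝ) (s k : ℕ) :
    ∑ i ∈ Finset.Ico (k * s) ((k + 1) * s), h i ≤ √s * blockNorm h s k := by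
  rw [blockNorm, ← Real.sqrt_mul (Nat.cast_nonneg s)]
  apply Real.le_sqrt_of_sq_le
  simpa only [card_block] using
    sq_sum_le_card_mul_sum_sq (s := Finset.Ico (k * s) ((k + 1) * s)) (f := h)

variable {V : Type*} [NormedAddCommGroup V] [InnerProductSpace ℝ V]

/-- Two distinct blocks have disjoint supports of total size `2s`; this is why order `2s` suffices.
-/
theorem restricted_isometry_block_pair {Ψ : (ℕ → ℝ) →ₗ[ℝ] V} {N s : ℕ} {α β : ℝ}
    (hΨ : ∀ (c : ℕ → ℝ) (S : Finset ℕ), S.card ≤ 2 * s → (∀ i ∉ S, c i = 0) →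
      (∀ i, N ≤ i → c i = 0) →
      α ^ 2 * ∑ i ∈ S, c i ^ 2 ≤ ‖Ψ c‖ ^ 2 ∧ ‖Ψ c‖ ^ 2 ≤ β ^ 2 * ∑ i ∈ S, c i ^ 2)
    {h : ℕ → ℝ} (hN : ∀ i, N ≤ i → h i = 0) {j k : ℕ} (hjk : j ≠ k) (p q : ℝ) :
    α ^ 2 * (p ^ 2 * blockNorm h s j ^ 2 + q ^ 2 * blockNorm h s k ^ 2) ≤
        ‖p • Ψ (block h s j) + q • Ψ (block h s k)‖ ^ 2 ∧
      ‖p • Ψ (block h s j) + q • Ψ (block h s k)‖ ^ 2 ≤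
        β ^ 2 * (p ^ 2 * blockNorm h s j ^ 2 + q ^ 2 * blockNorm h s k ^ 2) := by
  set I := Finset.Ico (j * s) ((j + 1) * s) with hI
  set J := Finset.Ico (k * s) ((k + 1) * s) with hJ
  have hd : Disjoint I J := by
    rw [hI, hJ, Finset.disjoint_left]
    intro i hi hi'
    rw [Finset.mem_Ico] at hi hi'
    rcases lt_or_gt_of_ne hjk with h | h
    · have := Nat.mul_le_mul_right s (Nat.succ_le_of_lt h)
      simp only [Nat.succ_eq_add_one] at this
      omega
    · have := Nat.mul_le_mul_right s (Nat.succ_le_of_lt h)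
      simp only [Nat.succ_eq_add_one] at this
      omega
  have key := hΨ (p • block h s j + q • block h s k) (I ∪ J)
    (by rw [Finset.card_union_of_disjoint hd, card_block, card_block]; omega)
    (fun i hi => by
      rw [Finset.mem_union, not_or] at hi
      simp [block, ← hI, ← hJ, hi.1, hi.2])
    (fun i hi => by simp [block, hN i hi])
  have hsum : ∑ i ∈ I ∪ J, (p • block h s j + q • block h s k) i ^ 2 =
      p ^ 2 * blockNorm h s j ^ 2 + q ^ 2 * blockNorm h s k ^ 2 := by
    rw [Finset.sum_union hd, sq_blockNorm, sq_blockNorm, Finset.mul_sum, Finset.mul_sum]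
    congr 1
    · refine Finset.sum_congr rfl fun i hi => ?_
      replace hi : i ∈ I := hi
      simp [block, ← hI, ← hJ, hi, Finset.disjoint_left.1 hd hi, mul_pow]
    · refine Finset.sum_congr rfl fun i hi => ?_
      replace hi : i ∈ J := hi
      simp [block, ← hI, ← hJ, hi, Finset.disjoint_right.1 hd hi, mul_pow]
  rwa [hsum, map_add, map_smul, map_smul] at key

/-- Contraction factor of the block argument. -/
def contraction (γ : ℝ) : ℝ := (1 + √2) * (γ - 1) / 4

/-- The threshold is `1 + 4/(1 + √2) = 4√2 - 3`. -/
theorem contraction_lt_one {γ : ℝ} (hγ : γ < 4 * √2 - 3) : contraction γ < 1 := by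
  have h2 : √2 ^ 2 = (2 : ℝ) := Real.sq_sqrt (by norm_num)
  have h0 : 0 ≤ √2 := Real.sqrt_nonneg 2
  rw [contraction]
  nlinarith

theorem sequence_error_bounds {Ψ : (ℕ → ℝ) →ₗ[ℝ] V} {N s : ℕ} (hs : 0 < s) {α β τ ρ : ℝ}
    (hα : 0 < α) (hαβ : α ≤ β) (hτ : 0 ≤ τ)
    (hγ : β ^ 2 / α ^ 2 < 4 * √2 - 3)
    (hΨ : ∀ (c : ℕ → ℝ) (S : Finset ℕ), S.card ≤ 2 * s → (∀ i ∉ S, c i = 0) →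
      (∀ i, N ≤ i → c i = 0) →
      α ^ 2 * ∑ i ∈ S, c i ^ 2 ≤ ‖Ψ c‖ ^ 2 ∧ ‖Ψ c‖ ^ 2 ≤ β ^ 2 * ∑ i ∈ S, c i ^ 2)
    {h : ℕ → ℝ} (hh : Antitone h) (h0 : ∀ i, 0 ≤ h i) (hN : ∀ i, N ≤ i → h i = 0)
    (hΨh : ‖Ψ h‖ ≤ 2 * β * τ)
    (hcone : ∑ i ∈ Finset.range N, h i ≤ 2 * ∑ i ∈ Finset.range s, h i + 2 * ρ) :
    ∑ i ∈ Finset.range N, h i ≤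
        2 * (1 + contraction (β ^ 2 / α ^ 2)) / (1 - contraction (β ^ 2 / α ^ 2)) * ρ +
          2 * (1 + √2) * (β ^ 2 / α ^ 2) / (1 - contraction (β ^ 2 / α ^ 2)) * √s * τ ∧
      √(∑ i ∈ Finset.range N, h i ^ 2) ≤
        2 * (1 + 2 * contraction (β ^ 2 / α ^ 2)) / (1 - contraction (β ^ 2 / α ^ 2)) * (ρ / √s) +
          3 * (1 + √2) * (β ^ 2 / α ^ 2) / (1 - contraction (β ^ 2 / α ^ 2)) * τ := by
  set γ := β ^ 2 / α ^ 2 with hγdef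
  set η := contraction γ with hη
  set b := blockNorm h s
  set l : ℕ → ℝ := fun k => ∑ i ∈ Finset.Ico (k * s) ((k + 1) * s), h i with hl
  have hη1 : η < 1 := contraction_lt_one hγ
  have hs' : (0 : ℝ) < √s := Real.sqrt_pos.2 (by exact_mod_cast hs)
  have hγ1 : 1 ≤ γ := by
    rw [hγdef, one_le_div (by positivity)]
    exact pow_le_pow_left₀ hα.le hαβ 2
  have hη0 : 0 ≤ η := by
    have : 0 ≤ γ - 1 := by linarith
    rw [hη, contraction]
    positivity
  have hb0 : ∀ k, 0 ≤ b k := fun k => Real.sqrt_nonneg _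
  have hl0 : ∀ k, 0 ≤ l k := fun k => Finset.sum_nonneg fun i _ => h0 i
  -- Since `s ≥ 1`, `N + 2` blocks cover all indices below `N`, and the excess is zero; no
  -- divisibility is needed.
  have hK : N ≤ (N + 2) * s := by nlinarith
  have hext : ∀ f : ℕ → ℝ, (∀ i, N ≤ i → f i = 0) →
      ∑ i ∈ Finset.range N, f i = ∑ i ∈ Finset.range ((N + 2) * s), f i := fun f hf =>
    Finset.sum_subset (Finset.range_mono hK) fun i _ hi => hf i (by simpa using hi)
  obtain ⟨hB0, hB1⟩ := leading_blocks_le (fun k => Ψ (block h s k)) b hb0 hα hαβ hτ N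
    (fun j k hjk p q => restricted_isometry_block_pair hΨ hN hjk p q) (by
      rwa [← map_sum, sum_block fun i hi => hN i (hK.trans hi)])
  rw [← hγdef] at hB0 hB1
  set σ := ∑ k ∈ Finset.range N, b (k + 2) with hσ
  set t := ∑ k ∈ Finset.range (N + 1), l (k + 1) with ht
  have htot : ∑ i ∈ Finset.range N, h i = l 0 + t := by
    rw [hext h hN, ← sum_sum_Ico_mul, Finset.sum_range_succ', add_comm]
  have hl0eq : ∑ i ∈ Finset.range s, h i = l 0 := by simp [hl]
  have ht0 : 0 ≤ t := Finset.sum_nonneg fun k _ => hl0 _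
  -- Block `k + 2` is charged to block `k + 1`; the last summand of `t` is discarded.
  have hσt : σ ≤ t / √s := by
    rw [ht, Finset.sum_range_succ, add_div, Finset.sum_div]
    refine (Finset.sum_le_sum fun k _ => blockNorm_succ_le hh h0 hs (k + 1)).trans ?_
    have := div_nonneg (hl0 (N + 1)) hs'.le
    simp only [hl] at this ⊢
    linarith
  have hσt' : √s * σ ≤ t := by
    rw [le_div_iff₀ hs'] at hσt
    linarith
  have hstep : (1 + √2) * (γ * τ + (γ - 1) / 4 * σ) = (1 + √2) * γ * τ + η * σ := by
    rw [hη, contraction]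
    ring
  rw [hstep] at hB0 hB1
  set κ := (1 + √2) * γ * τ with hκ
  have hκ0 : 0 ≤ κ := by positivity
  have hl0b : l 0 ≤ √s * b 0 := sum_block_le h s 0
  have hl0t : l 0 ≤ √s * κ + η * t := by
    have h1 := mul_le_mul_of_nonneg_left hB0 hs'.le
    have h2 := mul_le_mul_of_nonneg_left hσt' hη0
    linarith
  rw [hl0eq, htot] at hcone
  have h1η : 0 < 1 - η := by linarith
  -- The cone condition gives `t ≤ l 0 + 2ρ ≤ √s κ + η t + 2ρ`, which `η < 1` lets one solve for
  -- `t`.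
  have htb : t ≤ (√s * κ + 2 * ρ) / (1 - η) := by
    rw [le_div_iff₀ h1η]
    linarith
  constructor
  · have h1 : l 0 + t ≤ √s * κ + (1 + η) * ((√s * κ + 2 * ρ) / (1 - η)) := by
      have := mul_le_mul_of_nonneg_left htb (by linarith : 0 ≤ 1 + η)
      linarith
    rw [htot]
    refine h1.trans (le_of_eq ?_)
    rw [hκ]
    field_simp
    ring
  · have hn : √(∑ i ∈ Finset.range N, h i ^ 2) ≤ b 0 + b 1 + σ := by
      rw [hext (fun i => h i ^ 2) fun i hi => by simp [hN i hi], ← sum_sum_Ico_mul]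
      have hbs : ∑ k ∈ Finset.range (N + 2), b k = b 0 + b 1 + σ := by
        rw [Finset.sum_range_succ', Finset.sum_range_succ', hσ]
        ring
      rw [← hbs]
      refine Real.sqrt_le_iff.2 ⟨Finset.sum_nonneg fun k _ => hb0 k, ?_⟩
      simp_rw [← sq_blockNorm]
      exact Finset.sum_sq_le_sq_sum_of_nonneg fun k _ => hb0 k
    have h1 : b 0 + b 1 + σ ≤ 2 * κ + (1 + 2 * η) * (((√s * κ + 2 * ρ) / (1 - η)) / √s) := by
      have h2 : σ ≤ ((√s * κ + 2 * ρ) / (1 - η)) / √s :=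
        hσt.trans (div_le_div_of_nonneg_right htb hs'.le)
      have := mul_le_mul_of_nonneg_left h2 (by linarith : 0 ≤ 1 + 2 * η)
      linarith
    refine hn.trans (h1.trans (le_of_eq ?_))
    rw [hκ]
    field_simp
    ring

end Sequences

/-! ### The constants `α`, `β`, `γ`, `δ` -/

section Recovery

variable {N m : ℕ}

/-- Makes the set defining `alpha` bounded above, so its supremum is not a default value. -/
theorem exists_rank_le_schatten_two_pos (hN : 0 < N) {r : ℕ} (hr : 0 < r) :
    ∃ Z : Mat N, Z.rank ≤ r ∧ 0 < schatten 2 Z := by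
  let e : Fin N → ℝ := Pi.single ⟨0, hN⟩ 1
  refine ⟨Matrix.vecMulVec e e, (Matrix.rank_vecMulVec_le _ _).trans hr,
    (schatten_two_nonneg _).lt_of_ne' fun h => ?_⟩
  have := congrFun (congrFun (schatten_two_eq_zero h) ⟨0, hN⟩) ⟨0, hN⟩
  simp [Matrix.vecMulVec_apply, e] at this

/-- Makes the sets defining `beta` and `ripConst` nonempty, so their infima are genuine. -/
theorem exists_norm_measurement_le (A : Measurement N m) :
    ∃ b : ℝ, 0 ≤ b ∧ ∀ Z : Mat N, ‖A Z‖ ≤ b * schatten 2 Z := by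
  refine ⟨∑ i, ∑ j, ‖A (Matrix.single i j 1)‖,
    Finset.sum_nonneg fun i _ => Finset.sum_nonneg fun j _ => norm_nonneg _, fun Z => ?_⟩
  have hZ : A Z = ∑ i, ∑ j, Z i j • A (Matrix.single i j 1) := by
    conv_lhs => rw [Matrix.matrix_eq_sum_single Z]
    simp only [map_sum, ← map_smul, Matrix.smul_single, smul_eq_mul, mul_one]
  rw [hZ, Finset.sum_mul]
  refine (norm_sum_le _ _).trans (Finset.sum_le_sum fun i _ => ?_)
  rw [Finset.sum_mul]
  refine (norm_sum_le _ _).trans (Finset.sum_le_sum fun j _ => ?_)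
  rw [norm_smul, mul_comm]
  exact mul_le_mul_of_nonneg_left (abs_entry_le_schatten_two Z i j) (norm_nonneg _)

theorem beta_nonneg (A : Measurement N m) (r : ℕ) : 0 ≤ beta A r :=
  Real.sInf_nonneg fun _ hb => hb.1

theorem alpha_mul_schatten_two_le (A : Measurement N m) {r : ℕ} {Z : Mat N} (hZ : Z.rank ≤ r) :
    alpha A r * schatten 2 Z ≤ ‖A Z‖ := by
  rcases (schatten_two_nonneg Z).eq_or_lt with h | h
  · rw [← h, mul_zero]
    exact norm_nonneg _
  · rw [← le_div_iff₀ h]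
    refine csSup_le ⟨0, le_rfl, fun Z _ => by simp⟩ fun a ha => ?_
    rw [le_div_iff₀ h]
    exact ha.2 Z hZ

theorem le_alpha (hN : 0 < N) (A : Measurement N m) {r : ℕ} (hr : 0 < r) {a : ℝ} (ha : 0 ≤ a)
    (h : ∀ Z : Mat N, Z.rank ≤ r → a * schatten 2 Z ≤ ‖A Z‖) : a ≤ alpha A r := by
  obtain ⟨Z, hZ, hZ0⟩ := exists_rank_le_schatten_two_pos hN hr
  refine le_csSup ⟨‖A Z‖ / schatten 2 Z, fun b hb => ?_⟩ ⟨ha, h⟩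
  rw [le_div_iff₀ hZ0]
  exact hb.2 Z hZ

theorem norm_measurement_le_beta (A : Measurement N m) {r : ℕ} {Z : Mat N} (hZ : Z.rank ≤ r) :
    ‖A Z‖ ≤ beta A r * schatten 2 Z := by
  obtain ⟨b, hb0, hb⟩ := exists_norm_measurement_le A
  rcases (schatten_two_nonneg Z).eq_or_lt with h | h
  · have := hb Z
    rwa [← h, mul_zero] at this ⊢
  · rw [← div_le_iff₀ h]
    refine le_csInf ⟨b, hb0, fun Z _ => hb Z⟩ fun c hc => ?_
    rw [div_le_iff₀ h]
    exact hc.2 Z hZ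

theorem beta_le (A : Measurement N m) {r : ℕ} {b : ℝ} (hb : 0 ≤ b)
    (h : ∀ Z : Mat N, Z.rank ≤ r → ‖A Z‖ ≤ b * schatten 2 Z) : beta A r ≤ b :=
  csInf_le ⟨0, fun _ hc => hc.1⟩ ⟨hb, h⟩

theorem alpha_le_beta (hN : 0 < N) (A : Measurement N m) {r : ℕ} (hr : 0 < r) :
    alpha A r ≤ beta A r := by
  obtain ⟨Z, hZ, hZ0⟩ := exists_rank_le_schatten_two_pos hN hr
  exact le_of_mul_le_mul_right
    ((alpha_mul_schatten_two_le A hZ).trans (norm_measurement_le_beta A hZ)) hZ0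

theorem ripConst_le (A : Measurement N m) {r : ℕ} {δ : ℝ} (hδ : 0 ≤ δ)
    (h : ∀ Z : Mat N, Z.rank ≤ r → (1 - δ) * schatten 2 Z ^ 2 ≤ ‖A Z‖ ^ 2 ∧
      ‖A Z‖ ^ 2 ≤ (1 + δ) * schatten 2 Z ^ 2) : ripConst A r ≤ δ :=
  csInf_le ⟨0, fun _ hc => hc.1⟩ ⟨hδ, h⟩

theorem ripConst_nonneg (A : Measurement N m) (r : ℕ) : 0 ≤ ripConst A r :=
  Real.sInf_nonneg fun _ hb => hb.1

theorem restricted_isometry_ripConst (A : Measurement N m) {r : ℕ} {Z : Mat N} (hZ : Z.rank ≤ r) :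
    (1 - ripConst A r) * schatten 2 Z ^ 2 ≤ ‖A Z‖ ^ 2 ∧
      ‖A Z‖ ^ 2 ≤ (1 + ripConst A r) * schatten 2 Z ^ 2 := by
  obtain ⟨b, hb0, hb⟩ := exists_norm_measurement_le A
  have hb2 : ∀ Z : Mat N, ‖A Z‖ ^ 2 ≤ b ^ 2 * schatten 2 Z ^ 2 := fun Z => by
    rw [← mul_pow]
    exact pow_le_pow_left₀ (norm_nonneg _) (hb Z) 2
  have hne : {δ : ℝ | 0 ≤ δ ∧ ∀ Z : Mat N, Z.rank ≤ r →
      (1 - δ) * schatten 2 Z ^ 2 ≤ ‖A Z‖ ^ 2 ∧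
        ‖A Z‖ ^ 2 ≤ (1 + δ) * schatten 2 Z ^ 2}.Nonempty := by
    refine ⟨b ^ 2 + 1, by positivity, fun Z _ => ⟨?_, ?_⟩⟩
    · nlinarith [sq_nonneg (b * schatten 2 Z), sq_nonneg ‖A Z‖]
    · nlinarith [hb2 Z, sq_nonneg (schatten 2 Z)]
  rcases (schatten_two_nonneg Z).eq_or_lt with h | h
  · have := hb2 Z
    rw [← h] at this ⊢
    constructor
    · simp
    · simpa using this
  · have h2 : 0 < schatten 2 Z ^ 2 := by positivity
    constructor
    · have : 1 - ‖A Z‖ ^ 2 / schatten 2 Z ^ 2 ≤ ripConst A r := le_csInf hne fun δ hδ => by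
        rw [sub_le_comm, le_div_iff₀ h2]
        exact (hδ.2 Z hZ).1
      rwa [sub_le_comm, le_div_iff₀ h2] at this
    · have : ‖A Z‖ ^ 2 / schatten 2 Z ^ 2 - 1 ≤ ripConst A r := le_csInf hne fun δ hδ => by
        rw [sub_le_iff_le_add', div_le_iff₀ h2]
        exact (hδ.2 Z hZ).2
      rwa [sub_le_iff_le_add', div_le_iff₀ h2] at this

/-- Here `γ ≤ (1 + δ)/(1 - δ)`, and this is below `4√2 - 3` exactly when `δ < 2(3 - √2)/7`. -/
theorem alpha_pos_and_gamma_lt_of_ripConst_smul (hN : 0 < N) (A : Measurement N m) {r : ℕ}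
    (hr : 0 < r) {c : ℝ} (hc : 0 < c) (h : ripConst (c • A) r < 2 * (3 - √2) / 7) :
    0 < alpha A r ∧ gamma A r < 4 * √2 - 3 := by
  set δ := ripConst (c • A) r
  have h2 : √2 ^ 2 = (2 : ℝ) := Real.sq_sqrt (by norm_num)
  have hs1 : 1 ≤ √2 := Real.one_le_sqrt.2 (by norm_num)
  have hδ0 : 0 ≤ δ := ripConst_nonneg _ _
  have hδ1 : 0 < 1 - δ := by linarith
  have hrip : ∀ Z : Mat N, Z.rank ≤ r → (1 - δ) * schatten 2 Z ^ 2 ≤ (c * ‖A Z‖) ^ 2 ∧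
      (c * ‖A Z‖) ^ 2 ≤ (1 + δ) * schatten 2 Z ^ 2 := fun Z hZ => by
    have := restricted_isometry_ripConst (c • A) hZ
    rwa [LinearMap.smul_apply, norm_smul, Real.norm_of_nonneg hc.le] at this
  have hα : √(1 - δ) / c ≤ alpha A r := le_alpha hN A hr (by positivity) fun Z hZ => by
    rw [div_mul_eq_mul_div, div_le_iff₀ hc, mul_comm ‖A Z‖]
    refine le_of_sq_le_sq ?_ (by positivity)
    rw [mul_pow, Real.sq_sqrt hδ1.le]
    exact (hrip Z hZ).1
  have hβ : beta A r ≤ √(1 + δ) / c := beta_le A (by positivity) fun Z hZ => by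
    rw [div_mul_eq_mul_div, le_div_iff₀ hc, mul_comm ‖A Z‖]
    refine le_of_sq_le_sq ?_ (mul_nonneg (Real.sqrt_nonneg _) (schatten_two_nonneg Z))
    rw [mul_pow √_, Real.sq_sqrt (by linarith)]
    exact (hrip Z hZ).2
  have hα0 : 0 < alpha A r := lt_of_lt_of_le (by positivity) hα
  refine ⟨hα0, ?_⟩
  have hα2 : 1 - δ ≤ c ^ 2 * alpha A r ^ 2 := by
    have := pow_le_pow_left₀ (by positivity) hα 2
    rw [div_pow, Real.sq_sqrt hδ1.le, div_le_iff₀ (by positivity)] at this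
    linarith
  have hβ2 : c ^ 2 * beta A r ^ 2 ≤ 1 + δ := by
    have := pow_le_pow_left₀ (beta_nonneg A r) hβ 2
    rw [div_pow, Real.sq_sqrt (by linarith), le_div_iff₀ (by positivity)] at this
    linarith
  have hkey : 1 + δ < (4 * √2 - 3) * (1 - δ) := by nlinarith
  rw [gamma, div_lt_iff₀ (by positivity)]
  have hc2 : 0 < c ^ 2 := by positivity
  refine lt_of_mul_lt_mul_left ?_ hc2.le
  nlinarith

theorem exists_ripConst_smul_lt (hN : 0 < N) (A : Measurement N m) {r : ℕ} (hr : 0 < r)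
    (hα : 0 < alpha A r) (hγ : gamma A r < 4 * √2 - 3) :
    ∃ c : ℝ, 0 < c ∧ ripConst (c • A) r < 2 * (3 - √2) / 7 := by
  have h2 : √2 ^ 2 = (2 : ℝ) := Real.sq_sqrt (by norm_num)
  have hs0 : 0 ≤ √2 := Real.sqrt_nonneg 2
  rw [gamma, div_lt_iff₀ (by positivity)] at hγ
  have hαβ := alpha_le_beta hN A hr
  set α := alpha A r
  set β := beta A r
  have hS : 0 < α ^ 2 + β ^ 2 := by positivity
  have hle : α ^ 2 ≤ β ^ 2 := pow_le_pow_left₀ hα.le hαβ 2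
  have hc2 : √(2 / (α ^ 2 + β ^ 2)) ^ 2 = 2 / (α ^ 2 + β ^ 2) := Real.sq_sqrt (by positivity)
  -- This scaling centres `[α², β²]` at 1, with half-width `(γ - 1)/(γ + 1)`.
  refine ⟨√(2 / (α ^ 2 + β ^ 2)), by positivity,
    lt_of_le_of_lt (ripConst_le _ (δ := (β ^ 2 - α ^ 2) / (α ^ 2 + β ^ 2)) ?_ ?_) ?_⟩
  · exact div_nonneg (by linarith) hS.le
  · intro Z hZ
    have e1 : 1 - (β ^ 2 - α ^ 2) / (α ^ 2 + β ^ 2) = 2 / (α ^ 2 + β ^ 2) * α ^ 2 := by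
      field_simp; ring
    have e2 : 1 + (β ^ 2 - α ^ 2) / (α ^ 2 + β ^ 2) = 2 / (α ^ 2 + β ^ 2) * β ^ 2 := by
      field_simp; ring
    rw [LinearMap.smul_apply, norm_smul, Real.norm_of_nonneg (Real.sqrt_nonneg _), mul_pow, hc2,
      e1, e2, mul_assoc, mul_assoc, ← mul_pow, ← mul_pow]
    have hq : 0 ≤ 2 / (α ^ 2 + β ^ 2) := by positivity
    exact ⟨mul_le_mul_of_nonneg_left (pow_le_pow_left₀ (mul_nonneg hα.le (schatten_two_nonneg Z))
      (alpha_mul_schatten_two_le A hZ) 2) hq, mul_le_mul_of_nonneg_left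
      (pow_le_pow_left₀ (norm_nonneg _) (norm_measurement_le_beta A hZ) 2) hq⟩
  · rw [div_lt_div_iff₀ hS (by norm_num)]
    -- The goal reduces to `(1 + 2√2)β² < (13 - 2√2)α²`, and `(1 + 2√2)(4√2 - 3) = 13 - 2√2`.
    nlinarith [mul_lt_mul_of_pos_right hγ (by positivity : 0 < 1 + 2 * √2)]

/-! ### Cone condition and recovery -/

theorem rho_one_nonneg (s : ℕ) (X : Mat N) : 0 ≤ rho 1 s X := by
  refine Real.sInf_nonneg ?_
  rintro _ ⟨Y, -, rfl⟩
  exact schatten_one_nonneg _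

theorem rho_one_of_rank_le {s : ℕ} {X : Mat N} (hX : X.rank ≤ s) : rho 1 s X = 0 := by
  refine le_antisymm (csInf_le ⟨0, ?_⟩ ⟨X, hX, ?_⟩) (rho_one_nonneg s X)
  · rintro _ ⟨Y, -, rfl⟩
    exact schatten_one_nonneg _
  · rw [sub_self, schatten_one]
    simp [singVal]

/-- The tail of the singular values is at most the nuclear-norm error of rank-`s`
approximation. -/
theorem sum_tail_le_rho_one (s : ℕ) (X : Mat N) :
    ∑ i : Fin N, (if (i : ℕ) < s then 0 else singVal X i) ≤ rho 1 s X := by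
  refine le_csInf ⟨_, 0, by simp, rfl⟩ ?_
  rintro _ ⟨Y, hY, rfl⟩
  -- Mirsky's inequality for `X` and `Y`: past index `s` the singular values of `Y` vanish.
  refine le_trans (Finset.sum_le_sum fun i _ => ?_) (sum_abs_singVal_sub_le X Y)
  split_ifs with h
  · exact abs_nonneg _
  · rw [singVal_eq_zero_of_rank_le (hY.trans (not_lt.1 h)), sub_zero]
    exact le_abs_self _

/-- The cone condition satisfied by the error of a matrix of smaller nuclear norm. -/
theorem sum_singVal_sub_le_of_schatten_one_le (s : ℕ) {X Xs : Mat N}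
    (h : schatten 1 Xs ≤ schatten 1 X) :
    ∑ i, singVal (X - Xs) i ≤
      2 * ∑ i : Fin N, (if (i : ℕ) < s then singVal (X - Xs) i else 0) + 2 * rho 1 s X := by
  have h1 := sum_abs_singVal_sub_le X (X - Xs)
  rw [sub_sub_cancel] at h1
  have h2 := sum_tail_le_rho_one s X
  -- Termwise, `|x - h|` is bounded below by `x - h` in the head and by `h - x` in the tail.
  have h3 : ∑ i : Fin N, (singVal X i + singVal (X - Xs) i
      - 2 * (if (i : ℕ) < s then singVal (X - Xs) i else 0)
      - 2 * (if (i : ℕ) < s then 0 else singVal X i)) ≤ ∑ i, |singVal X i - singVal (X - Xs) i| :=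
    Finset.sum_le_sum fun i _ => by
      split_ifs
      · linarith [le_abs_self (singVal X i - singVal (X - Xs) i)]
      · linarith [neg_abs_le (singVal X i - singVal (X - Xs) i)]
  rw [Finset.sum_sub_distrib, Finset.sum_sub_distrib, Finset.sum_add_distrib, ← Finset.mul_sum,
    ← Finset.mul_sum, ← schatten_one X] at h3
  linarith

/-- Reduces to `sequence_error_bounds` for the singular values of `X - Xs`, with `A` composed with
synthesis in its singular bases as `Ψ`. -/
theorem error_bounds (hN : 0 < N) {s : ℕ} (hs : 0 < s) (A : Measurement N m)
    (hα : 0 < alpha A (2 * s)) (hγ : gamma A (2 * s) < 4 * √2 - 3) {X : Mat N} {θ : ℝ}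
    {y : EuclideanSpace ℝ (Fin m)} (hθ : 0 ≤ θ) (hX : Feasible A s θ y X) {Xs : Mat N}
    (hXs : IsSolution 1 θ A s y Xs) :
    schatten 1 (X - Xs) ≤
        2 * (1 + contraction (gamma A (2 * s))) / (1 - contraction (gamma A (2 * s))) * rho 1 s X +
          2 * (1 + √2) * gamma A (2 * s) / (1 - contraction (gamma A (2 * s))) * √s * θ ∧
      schatten 2 (X - Xs) ≤
        2 * (1 + 2 * contraction (gamma A (2 * s))) / (1 - contraction (gamma A (2 * s))) *
            (rho 1 s X / √s) +
          3 * (1 + √2) * gamma A (2 * s) / (1 - contraction (gamma A (2 * s))) * θ := by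
  obtain ⟨u, v, huv⟩ := exists_synthesis_eq (X - Xs)
  set h : ℕ → ℝ := ⇑(Matrix.toEuclideanLin (X - Xs)).singularValues
  have hhN : ∀ i, N ≤ i → h i = 0 := fun i hi =>
    LinearMap.singularValues_of_finrank_le _ (by simpa using hi)
  have hsum : ∀ f : ℕ → ℝ, ∑ i : Fin N, f i = ∑ i ∈ Finset.range N, f i := fun f =>
    Fin.sum_univ_eq_sum_range f N
  have hΨ : ∀ (c : ℕ → ℝ) (S : Finset ℕ), S.card ≤ 2 * s → (∀ i ∉ S, c i = 0) →
      (∀ i, N ≤ i → c i = 0) →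
      alpha A (2 * s) ^ 2 * ∑ i ∈ S, c i ^ 2 ≤ ‖(A ∘ₗ synthesis u v) c‖ ^ 2 ∧
        ‖(A ∘ₗ synthesis u v) c‖ ^ 2 ≤ beta A (2 * s) ^ 2 * ∑ i ∈ S, c i ^ 2 := by
    intro c S hS hcS hcN
    have hr := (rank_synthesis_le u v c S hcS).trans hS
    have hn : ∑ i ∈ S, c i ^ 2 = schatten 2 (synthesis u v c) ^ 2 := by
      rw [sq_schatten_two_synthesis, hsum fun i => c i ^ 2]
      have h1 : ∑ i ∈ S, c i ^ 2 = ∑ i ∈ S ∪ Finset.range N, c i ^ 2 :=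
        Finset.sum_subset Finset.subset_union_left fun i _ hi => by simp [hcS i hi]
      have h2 : ∑ i ∈ Finset.range N, c i ^ 2 = ∑ i ∈ S ∪ Finset.range N, c i ^ 2 :=
        Finset.sum_subset Finset.subset_union_right fun i _ hi => by
          simp [hcN i (by simpa using hi)]
      rw [h1, h2]
    rw [hn, ← mul_pow, ← mul_pow, LinearMap.comp_apply]
    exact ⟨pow_le_pow_left₀ (mul_nonneg hα.le (schatten_two_nonneg _))
      (alpha_mul_schatten_two_le A hr) 2,
      pow_le_pow_left₀ (norm_nonneg _) (norm_measurement_le_beta A hr) 2⟩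
  have hΨh : ‖(A ∘ₗ synthesis u v) h‖ ≤ 2 * beta A (2 * s) * θ := by
    rw [LinearMap.comp_apply, huv, map_sub]
    have e : A X - A Xs = (A X - y) - (A Xs - y) := by abel
    rw [e]
    have h1 : ‖A X - y‖ ≤ beta A (2 * s) * θ := hX
    have h2 : ‖A Xs - y‖ ≤ beta A (2 * s) * θ := hXs.1
    linarith [norm_sub_le (A X - y) (A Xs - y)]
  have hcone : ∑ i ∈ Finset.range N, h i ≤
      2 * ∑ i ∈ Finset.range s, h i + 2 * rho 1 s X := by
    have h1 := sum_singVal_sub_le_of_schatten_one_le s (hXs.2 X hX)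
    have h2 : ∑ i : Fin N, (if (i : ℕ) < s then singVal (X - Xs) i else 0) ≤
        ∑ i ∈ Finset.range s, h i := by
      refine (hsum fun i => if i < s then h i else 0).le.trans ?_
      rw [← Finset.sum_filter]
      exact Finset.sum_le_sum_of_subset_of_nonneg (fun i hi => by
        simpa using (Finset.mem_filter.1 hi).2)
        fun i _ _ => LinearMap.singularValues_nonneg _ i
    have h3 : ∑ i, singVal (X - Xs) i = ∑ i ∈ Finset.range N, h i := hsum h
    linarith
  have key := sequence_error_bounds hs hα (alpha_le_beta hN A (by omega)) hθ hγ hΨ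
    (LinearMap.singularValues_antitone _) (LinearMap.singularValues_nonneg _) hhN hΨh hcone
  have e1 : schatten 1 (X - Xs) = ∑ i ∈ Finset.range N, h i := by
    rw [schatten_one]
    exact hsum h
  have e2 : schatten 2 (X - Xs) = √(∑ i ∈ Finset.range N, h i ^ 2) := by
    rw [schatten_two]
    exact congrArg _ (hsum fun i => h i ^ 2)
  rw [e1, e2]
  exact key

/-- With `ρ = θ = 0` the Frobenius bound forces every solution to equal `X`; that `X` is itself a
solution then follows from existence. -/
theorem isSolution_iff_eq (hN : 0 < N) {s : ℕ} (hs : 0 < s) (A : Measurement N m)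
    (hα : 0 < alpha A (2 * s)) (hγ : gamma A (2 * s) < 4 * √2 - 3) {X : Mat N} (hX : X.rank ≤ s)
    (Xs : Mat N) : IsSolution 1 0 A s (A X) Xs ↔ Xs = X := by
  have hf : Feasible A s 0 (A X) X := by simp [Feasible]
  have huniq : ∀ Z, IsSolution 1 0 A s (A X) Z → Z = X := fun Z hZ => by
    have := (error_bounds hN hs A hα hγ le_rfl hf hZ).2
    rw [rho_one_of_rank_le hX, zero_div, mul_zero, mul_zero, add_zero] at this
    exact (sub_eq_zero.1 (schatten_two_eq_zero (this.antisymm (schatten_two_nonneg _)))).symm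
  refine ⟨huniq Xs, ?_⟩
  rintro rfl
  obtain ⟨Z, hZ⟩ := exists_isSolution A s 0 (A Xs) Xs hf
  exact huniq Z hZ ▸ hZ

end Recovery

end LowRankRecovery

end

/-- In order: the condition `γ_{2s} < 4√2 - 3` is the condition `δ_{2s} < 2(3 - √2)/7` up to
rescaling `A` (and follows from it for `A` itself); under it, exact recovery of matrices of rank at
most `s` by `(P_1)`; and, for every `X`, solvability of `(P_{1,θ})` together with the error bounds.
For `θ = 0` the bounds say that `(P_1)` is stable. The constants depend on `γ_{2s}` only. -/
theorem mainTheorem8 :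
    ∃ C₁ D₁ C₂ D₂ : ℝ → ℝ,
      ∀ (N m s : ℕ), 0 < N → 0 < s → ∀ A : LowRankRecovery.Measurement N m,
        ((0 < LowRankRecovery.alpha A (2 * s) ∧
            LowRankRecovery.gamma A (2 * s) < 4 * √2 - 3) ↔
          ∃ c : ℝ, 0 < c ∧ LowRankRecovery.ripConst (c • A) (2 * s) < 2 * (3 - √2) / 7) ∧
        (LowRankRecovery.ripConst A (2 * s) < 2 * (3 - √2) / 7 →
          0 < LowRankRecovery.alpha A (2 * s) ∧
            LowRankRecovery.gamma A (2 * s) < 4 * √2 - 3) ∧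
        (0 < LowRankRecovery.alpha A (2 * s) →
          LowRankRecovery.gamma A (2 * s) < 4 * √2 - 3 →
          (∀ X : LowRankRecovery.Mat N, X.rank ≤ s →
            ∀ Xs : LowRankRecovery.Mat N,
              LowRankRecovery.IsSolution 1 0 A s (A X) Xs ↔ Xs = X) ∧
          (∀ (X : LowRankRecovery.Mat N) (θ : ℝ) (y : EuclideanSpace ℝ (Fin m)), 0 ≤ θ →
            LowRankRecovery.Feasible A s θ y X →
            (∃ Xs : LowRankRecovery.Mat N, LowRankRecovery.IsSolution 1 θ A s y Xs) ∧
            ∀ Xs : LowRankRecovery.Mat N, LowRankRecovery.IsSolution 1 θ A s y Xs →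
              LowRankRecovery.schatten 1 (X - Xs) ≤
                C₁ (LowRankRecovery.gamma A (2 * s)) * LowRankRecovery.rho 1 s X +
                  D₁ (LowRankRecovery.gamma A (2 * s)) * √(s : ℝ) * θ ∧
              LowRankRecovery.schatten 2 (X - Xs) ≤
                C₂ (LowRankRecovery.gamma A (2 * s)) * (LowRankRecovery.rho 1 s X / √(s : ℝ)) +
                  D₂ (LowRankRecovery.gamma A (2 * s)) * θ)) := by
  refine ⟨fun γ => 2 * (1 + LowRankRecovery.contraction γ) / (1 - LowRankRecovery.contraction γ),
    fun γ => 2 * (1 + √2) * γ / (1 - LowRankRecovery.contraction γ),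
    fun γ => 2 * (1 + 2 * LowRankRecovery.contraction γ) / (1 - LowRankRecovery.contraction γ),
    fun γ => 3 * (1 + √2) * γ / (1 - LowRankRecovery.contraction γ),
    fun N m s hN hs A => ?_⟩
  have hr : 0 < 2 * s := by omega
  refine ⟨⟨fun h => LowRankRecovery.exists_ripConst_smul_lt hN A hr h.1 h.2, ?_⟩, fun h => ?_,
    fun hα hγ => ⟨fun X hX Xs => LowRankRecovery.isSolution_iff_eq hN hs A hα hγ hX Xs,
      fun X θ y hθ hX => ⟨LowRankRecovery.exists_isSolution A s θ y X hX, fun Xs hXs =>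
        LowRankRecovery.error_bounds hN hs A hα hγ hθ hX hXs⟩⟩⟩
  · rintro ⟨c, hc, h⟩
    exact LowRankRecovery.alpha_pos_and_gamma_lt_of_ripConst_smul hN A hr hc h
  · exact LowRankRecovery.alpha_pos_and_gamma_lt_of_ripConst_smul hN A hr one_pos
      (by rwa [one_smul])
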